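/- Let $p_n$ denote the $n$-th prime number and let $\Phi_n(x)=\sum_{j=0}^{\varphi(n)}a_n(j)x^j\in\mathbb Z[x]$ denote the $n$-th cyclotomic polynomial ($n\ge 1$). Suppose that Andrica's conjecture holds, i.e. that $$\sqrt{p_{n+1}}-\sqrt{p_n}<1\qquad\text{for all } n\ge 1.$$ Then every positive integer occurs as the maximum coefficient of some cyclotomic polynomial: for every integer $m\ge 1$ there is an integer $n\ge 1$ such that $$\max_{0\le j\le\varphi(n)}a_n(j)=m.$$ -/

import Mathlib

/-- Andrica's conjecture: consecutive primes `p < p'` satisfy `√p' - √p < 1`.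
`Nat.nth Nat.Prime` lists the primes starting from index `0`, so `n : ℕ` runs over all
pairs of consecutive primes, beginning with `(2, 3)`. -/
def AndricaConjecture : Prop :=
  ∀ n : ℕ, √(Nat.nth Nat.Prime (n + 1) : ℝ) - √(Nat.nth Nat.Prime n : ℝ) < 1

/-!
For `m = 1` take `Φ_1`. For `m ≥ 2` the integer `n` is a product of three primes `p < q < r` with
`q ≡ -1` and `r m ≡ 1` modulo `p`.

Since `Φ_{pqr} = Φ_{pq}(X ^ r) / Φ_{pq}` and `1 / Φ_{pq}` is
`(1 + ⋯ + X ^ (p - 1)) (1 - X ^ q) / (1 - X ^ (p q))`, a coefficient of `Φ_{pqr}` at `n` is a signed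
sum of the coefficients of `Φ_{pq}` at those `i ≤ n / r` for which `n - r i` lies in `[0, p)` or in
`[q, q + p)` modulo `p q`. Write residues modulo `p q` as `q x + p y`. For each `x` modulo `p` there
is exactly one `y` modulo `q` of the first kind, and the second kind is obtained from it by
replacing `x` by `x - m`. So the coefficient is a sum over `x` modulo `p` of differences
`A x y - A (x - m) y` of truncated coefficients of `Φ_{pq}`
(`coeff_cyclotomic_eq_sum_of_shortResidue_eq_one`).

For `q = l p - 1` the coefficients of `Φ_{pq}` are so simple
(`cyclotomic_prime_mul_prime_of_add_one_eq`) that each difference is seen to be at most `1` if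
`x < m` and at most `0` if `x ≥ m`, for any `y` and any truncation (`truncatedCoeff_sub_le`). Hence
no coefficient of `Φ_{pqr}` exceeds `m`.

To attain `m`, the values of `y` have to be controlled. Let `p = m K + 1` and `q + 1 = K d`, and let
`r ≡ -K` modulo `p`, `r p ≡ -K` modulo `q`. The residue `j < p` with `j ≡ n - r (q x + p y)` moves
`x` by `m` and `y` by `d` as it grows by `1`; after `K` steps `x` has moved by `-1` and `y`, as
`K d ≡ 1` modulo `q`, by `1` only. So `y` is close to `e d`, where `e = j % K`. Starting from
`x = m - 2`, `y = 0`, the indices `x ≤ m - 2` get small values `y < l`, and `x = m - 1` gets a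
value slightly above `d`. With truncation at `m q` all these differences are `1`, and the others
are `0` (`truncatedCoeff_sub_eq`).
-/

/-! ### Cyclotomic polynomials of two and three primes -/

open Polynomial in
theorem cyclotomic_mul_prime_prime {p q : ℕ} (hp : p.Prime) (hq : q.Prime) (hpq : p ≠ q) :
    cyclotomic (p * q) ℤ * ((X ^ p - 1) * (X ^ q - 1)) = (X ^ (p * q) - 1) * (X - 1) := by
  have := Fact.mk hp
  have := Fact.mk hq
  have h1 := cyclotomic_expand_eq_cyclotomic_mul (n := p) hq
    (fun h => hpq ((Nat.prime_dvd_prime_iff_eq hq hp).1 h).symm) ℤ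
  have h2 := cyclotomic_prime_mul_X_sub_one ℤ p
  have h3 := congrArg (expand ℤ q) h2
  simp only [map_mul, map_sub, map_pow, expand_X, map_one, h1] at h3
  rw [← h2, mul_comm p q, pow_mul, ← h3, mul_comm q p]
  ring

open Polynomial in
/-- The factorization pattern of `Φ_{pq}` for `q ≡ -1` modulo `p`. The
monomials on the right are pairwise distinct, so the formula displays every nonzero
coefficient of `Φ_{pq}`. -/
theorem cyclotomic_prime_mul_prime_of_add_one_eq {p q l : ℕ} (hp : p.Prime) (hq : q.Prime)
    (hpq : p ≠ q) (hl : q + 1 = l * p) :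
    cyclotomic (p * q) ℤ = (∑ x ∈ Finset.range (p - 1), X ^ (q * x)) *
      (∑ y ∈ Finset.range l, X ^ (p * y)) - X * ∑ y ∈ Finset.range (q - l), X ^ (p * y) := by
  have hX : ∀ {k : ℕ}, k.Prime → (X ^ k - 1 : ℤ[X]) ≠ 0 := fun hk =>
    X_pow_sub_C_ne_zero hk.pos 1
  apply mul_right_cancel₀ (mul_ne_zero (hX hp) (hX hq))
  rw [cyclotomic_mul_prime_prime hp hq hpq]
  obtain ⟨s, rfl⟩ : ∃ s, p = s + 1 := ⟨p - 1, by have := hp.pos; omega⟩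
  have hlq : l ≤ q := by
    have := hp.two_le
    have := hq.two_le
    by_contra! h
    nlinarith
  obtain ⟨u, rfl⟩ : ∃ u, q = l + u := ⟨q - l, by omega⟩
  have g1 := geom_sum_mul (X ^ (l + u) : ℤ[X]) s
  have g2 := geom_sum_mul (X ^ (s + 1) : ℤ[X]) l
  have g3 := geom_sum_mul (X ^ (s + 1) : ℤ[X]) u
  simp only [← pow_mul] at g1 g2 g3
  have e1 : (s + 1) * l = l + u + 1 := by rw [hl, mul_comm]
  have e2 : (s + 1) * (l + u) = (l + u) * s + (l + u) := by ring
  have e3 : (s + 1) * u + 1 = (l + u) * s := by nlinarith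
  have e4 : (X : ℤ[X]) ^ ((s + 1) * u) * X = X ^ ((l + u) * s) := by rw [← e3, pow_succ]
  have e5 : l + u - l = u := by omega
  rw [e5, Nat.add_sub_cancel]
  rw [e1, pow_succ] at g2
  rw [e2, pow_add (X : ℤ[X]) ((l + u) * s)]
  linear_combination (-(∑ y ∈ Finset.range l, X ^ ((s + 1) * y)) * (X ^ (s + 1) - 1)) * g1
    - (X ^ ((l + u) * s) - 1) * g2 + X * (X ^ (l + u) - 1) * g3 + (X ^ (l + u) - 1) * e4

open Polynomial in
theorem cyclotomic_mul_one_sub_X_pow {p q r : ℕ} (hp : p.Prime) (hq : q.Prime) (hr : r.Prime)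
    (hpq : p ≠ q) (hpr : p ≠ r) (hqr : q ≠ r) :
    cyclotomic (p * q * r) ℤ * (1 - X ^ (p * q)) =
      expand ℤ r (cyclotomic (p * q) ℤ) * ((∑ j ∈ Finset.range p, X ^ j) * (1 - X ^ q)) := by
  have hr' : ¬ r ∣ p * q := by
    rw [hr.dvd_mul, Nat.prime_dvd_prime_iff_eq hr hp, Nat.prime_dvd_prime_iff_eq hr hq]
    exact fun h => h.elim (fun h => hpr h.symm) (fun h => hqr h.symm)
  have h1 := cyclotomic_mul_prime_prime hp hq hpq
  have h2 := geom_sum_mul (X : ℤ[X]) p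
  rw [cyclotomic_expand_eq_cyclotomic_mul hr hr' ℤ]
  apply mul_right_cancel₀ (X_sub_C_ne_zero (1 : ℤ))
  rw [C_1]
  linear_combination cyclotomic (p * q * r) ℤ * h1 +
    cyclotomic (p * q * r) ℤ * cyclotomic (p * q) ℤ * (X ^ q - 1) * h2

/-- The `p q`-periodic indicator of the integers whose least nonnegative residue modulo `p q` is
less than `p`. -/
def shortResidue (p q : ℕ) (z : ℤ) : ℤ := if z % (p * q : ℕ) < p then 1 else 0

theorem shortResidue_sub_mul (p q : ℕ) (z : ℤ) :
    shortResidue p q (z - (p * q : ℕ)) = shortResidue p q z := by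
  simp only [shortResidue, Int.sub_emod_right]

theorem shortResidue_congr {p q : ℕ} {z w : ℤ} (h : z ≡ w [ZMOD (p * q : ℕ)]) :
    shortResidue p q z = shortResidue p q w := by
  simp only [shortResidue, h.eq]

theorem shortResidue_of_nonneg_of_lt {p q : ℕ} {z : ℤ} (h0 : 0 ≤ z) (h1 : z < (p * q : ℕ)) :
    shortResidue p q z = if z < p then 1 else 0 := by
  simp only [shortResidue, Int.emod_eq_of_lt h0 h1]

open PowerSeries in
theorem mk_shortResidue_mul {p q : ℕ} (hpq : p + q ≤ p * q) :
    (PowerSeries.mk fun z : ℕ => shortResidue p q z - shortResidue p q (z - q)) *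
      (1 - X ^ (p * q)) = (∑ j ∈ Finset.range p, (X : ℤ⟦X⟧) ^ j) * (1 - X ^ q) := by
  ext z
  have hs : ∀ k : ℕ, coeff k (∑ j ∈ Finset.range p, (X : ℤ⟦X⟧) ^ j) = if k < p then 1 else 0 := by
    intro k
    simp [coeff_X_pow]
  rw [mul_sub, mul_sub, mul_one, mul_one, map_sub, map_sub, coeff_mul_X_pow', coeff_mul_X_pow',
    hs, hs, coeff_mk]
  by_cases hz : p * q ≤ z
  · rw [if_pos hz, coeff_mk, Nat.cast_sub hz, shortResidue_sub_mul, sub_right_comm (z : ℤ),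
      shortResidue_sub_mul, if_neg (by omega), if_pos (by omega), if_neg (by omega)]
    ring
  · rw [if_neg hz, shortResidue_of_nonneg_of_lt (by omega) (by omega)]
    by_cases hzq : q ≤ z
    · rw [shortResidue_of_nonneg_of_lt (by omega) (by omega), if_pos hzq]
      split_ifs <;> omega
    · rw [if_neg hzq, shortResidue_congr (w := (z : ℤ) - q + (p * q : ℕ)) (by
          rw [Int.modEq_iff_dvd]; exact ⟨1, by ring⟩),
        shortResidue_of_nonneg_of_lt (by omega) (by omega),
        if_neg (c := (z : ℤ) - q + (p * q : ℕ) < p) (by omega)]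
      simp

open PowerSeries in
/-- `Φ_{pqr}` is `Φ_{pq}(X ^ r)` times the power series of `(1 + ⋯ + X ^ (p - 1)) (1 - X ^ q) /
(1 - X ^ (p q))`, whose coefficients are periodic. -/
theorem cyclotomic_eq_expand_mul_mk {p q r : ℕ} (hp : p.Prime) (hq : q.Prime) (hr : r.Prime)
    (hpq : p ≠ q) (hpr : p ≠ r) (hqr : q ≠ r) :
    (Polynomial.cyclotomic (p * q * r) ℤ : ℤ⟦X⟧) =
      (Polynomial.expand ℤ r (Polynomial.cyclotomic (p * q) ℤ) : ℤ⟦X⟧) *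
      PowerSeries.mk fun z : ℕ => shortResidue p q z - shortResidue p q (z - q) := by
  have hne : (1 - X ^ (p * q) : ℤ⟦X⟧) ≠ 0 := by
    intro h
    have := congrArg (coeff 0) h
    rw [map_sub, coeff_X_pow, if_neg (Nat.mul_pos hp.pos hq.pos).ne] at this
    simp at this
  have hle : p + q ≤ p * q := by
    rcases Nat.lt_or_gt_of_ne hpq with h | h <;> nlinarith [hp.two_le, hq.two_le]
  apply mul_right_cancel₀ hne
  conv_rhs => rw [mul_assoc, mk_shortResidue_mul hle]
  have h := congrArg (Polynomial.coeToPowerSeries.ringHom (R := ℤ))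
    (cyclotomic_mul_one_sub_X_pow hp hq hr hpq hpr hqr)
  simpa only [map_mul, map_sub, map_one, map_pow, map_sum,
    Polynomial.coeToPowerSeries.ringHom_apply, Polynomial.coe_X] using h

/-! ### The coefficients as sums over the residues modulo the smallest prime -/

/-- With `q + 1 = l p`, every residue modulo `p q` is `q x + p y` for a unique `x < p`, `y < q`, and
the coefficient of `Φ_{pq}` at it is `1` if `x < p - 1` and `y < l` (the exponent being
`q x + p y`), `-1` if `x = p - 1` and `y ≥ l` (the exponent being `p y - q`), and `0` otherwise.
`truncatedCoeff p q l r n x y` is this coefficient if `r` times the exponent is at most `n`, and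
`0` otherwise; in the second case the bound `r (p y - q) ≤ n` is written without subtraction. -/
def truncatedCoeff (p q l r n x y : ℕ) : ℤ :=
  if y < l then if x < p - 1 ∧ r * (q * x + p * y) ≤ n then 1 else 0
  else if x = p - 1 ∧ r * (p * y) ≤ n + r * q then -1 else 0

open PowerSeries in
theorem coeff_cyclotomic_eq_sum {p q r l : ℕ} (hp : p.Prime) (hq : q.Prime) (hr : r.Prime)
    (hpq : p ≠ q) (hpr : p ≠ r) (hqr : q ≠ r) (hl : q + 1 = l * p) (n : ℕ) :
    (Polynomial.cyclotomic (p * q * r) ℤ).coeff n =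
      ∑ x ∈ Finset.range p, ∑ y ∈ Finset.range q, truncatedCoeff p q l r n x y *
        (shortResidue p q (n - r * (q * x + p * y)) -
          shortResidue p q (n - r * (q * x + p * y) - q)) := by
  have hB : Polynomial.expand ℤ r (Polynomial.cyclotomic (p * q) ℤ) =
      (∑ x ∈ Finset.range (p - 1), ∑ y ∈ Finset.range l, Polynomial.X ^ (r * (q * x + p * y))) -
        ∑ y ∈ Finset.range (q - l), Polynomial.X ^ (r * (1 + p * y)) := by
    rw [cyclotomic_prime_mul_prime_of_add_one_eq hp hq hpq hl, Finset.sum_mul_sum, Finset.mul_sum]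
    simp only [map_sub, map_sum, ← pow_add, ← pow_succ', map_pow, Polynomial.expand_X, ← pow_mul,
      add_comm 1]
  have hB' := congrArg (Polynomial.coeToPowerSeries.ringHom (R := ℤ)) hB
  simp only [map_sub, map_sum, map_pow, Polynomial.coeToPowerSeries.ringHom_apply,
    Polynomial.coe_X] at hB'
  have key : ∀ k : ℕ, coeff n ((X : ℤ⟦X⟧) ^ k *
      PowerSeries.mk fun z : ℕ => shortResidue p q z - shortResidue p q (z - q)) =
      if k ≤ n then shortResidue p q (n - k) - shortResidue p q (n - k - q) else 0 := by
    intro k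
    rw [coeff_X_pow_mul']
    by_cases hk : k ≤ n
    · rw [if_pos hk, if_pos hk, coeff_mk, Nat.cast_sub hk]
    · rw [if_neg hk, if_neg hk]
  rw [← Polynomial.coeff_coe, cyclotomic_eq_expand_mul_mk hp hq hr hpq hpr hqr, hB', sub_mul,
    Finset.sum_mul, Finset.sum_mul, map_sub, map_sum, map_sum]
  simp only [Finset.sum_mul, map_sum, key]
  have hlq : l ≤ q := by
    have := hp.two_le
    have := hq.two_le
    by_contra! h
    nlinarith
  obtain ⟨s, rfl⟩ : ∃ s, p = s + 1 := ⟨p - 1, by have := hp.pos; omega⟩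
  obtain ⟨u, rfl⟩ : ∃ u, q = l + u := ⟨q - l, by omega⟩
  simp only [Nat.add_sub_cancel, Nat.add_sub_cancel_left]
  rw [Finset.sum_range_succ, sub_eq_add_neg]
  congr 1
  · refine Finset.sum_congr rfl fun x hx => ?_
    rw [Finset.mem_range] at hx
    rw [Finset.sum_range_add]
    rw [Finset.sum_eq_zero (s := Finset.range u), add_zero]
    · refine Finset.sum_congr rfl fun y hy => ?_
      rw [Finset.mem_range] at hy
      simp only [truncatedCoeff, Nat.add_sub_cancel, hx, hy, if_true, true_and]
      split_ifs <;> simp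
    · intro y _
      simp [truncatedCoeff, hx.ne]
  · rw [Finset.sum_range_add]
    rw [Finset.sum_eq_zero (s := Finset.range l), zero_add, ← Finset.sum_neg_distrib]
    · refine Finset.sum_congr rfl fun y hy => ?_
      have e1 : (s + 1) * (l + y) = (l + u) + (1 + (s + 1) * y) := by
        rw [mul_add, mul_comm _ l, ← hl]; ring
      have e2 : r * ((s + 1) * (l + y)) ≤ n + r * (l + u) ↔ r * (1 + (s + 1) * y) ≤ n := by
        rw [e1, mul_add]; omega
      have e3 : ((n : ℤ) -
            (r : ℤ) * (((l + u : ℕ) : ℤ) * s + ((s + 1 : ℕ) : ℤ) * ((l + y : ℕ) : ℤ))) ≡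
          n - ((r * (1 + (s + 1) * y) : ℕ) : ℤ) [ZMOD ((s + 1) * (l + u) : ℕ)] := by
        rw [Int.modEq_iff_dvd]
        refine ⟨r, ?_⟩
        have : (((s + 1) * (l + y) : ℕ) : ℤ) = ((l + u) + (1 + (s + 1) * y) : ℕ) := by rw [e1]
        push_cast at this ⊢
        linear_combination (r : ℤ) * this
      rw [shortResidue_congr e3, shortResidue_congr (e3.sub_right _)]
      simp only [truncatedCoeff, Nat.add_sub_cancel, if_neg (not_lt.2 (Nat.le_add_right l y)), e2,
        true_and]
      split_ifs <;> simp
    · intro y hy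
      simp [truncatedCoeff, Finset.mem_range.1 hy]

theorem add_sub_mod_eq {p m x : ℕ} (hm : m < p) (hx : x < p) :
    (x + (p - m)) % p = if x < m then x + (p - m) else x - m := by
  split_ifs with h
  · exact Nat.mod_eq_of_lt (by omega)
  · rw [show x + (p - m) = x - m + p by omega, Nat.add_mod_right, Nat.mod_eq_of_lt (by omega)]

/-- The second shift by `q` of `shortResidue` in `coeff_cyclotomic_eq_sum` amounts to a rotation of
`x` by `m = r⁻¹` modulo `p`, with the same `y`. -/
theorem coeff_cyclotomic_eq_sum_sub {p q r l m : ℕ} (hp : p.Prime) (hq : q.Prime) (hr : r.Prime)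
    (hpq : p ≠ q) (hpr : p ≠ r) (hqr : q ≠ r) (hl : q + 1 = l * p) (hm : m < p)
    (hrm : r * m ≡ 1 [MOD p]) (n : ℕ) :
    (Polynomial.cyclotomic (p * q * r) ℤ).coeff n =
      ∑ x ∈ Finset.range p, ∑ y ∈ Finset.range q, shortResidue p q (n - r * (q * x + p * y)) *
        (truncatedCoeff p q l r n x y - truncatedCoeff p q l r n ((x + (p - m)) % p) y) := by
  rw [coeff_cyclotomic_eq_sum hp hq hr hpq hpr hqr hl]
  simp only [mul_sub, Finset.sum_sub_distrib]
  congr 1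
  · simp only [mul_comm]
  · rw [Finset.sum_comm, Finset.sum_comm (s := Finset.range p)]
    refine Finset.sum_congr rfl fun y _ => ?_
    refine Finset.sum_nbij' (fun x => (x + m) % p) (fun x => (x + (p - m)) % p) ?_ ?_ ?_ ?_ ?_
    · exact fun x _ => Finset.mem_range.2 (Nat.mod_lt _ hp.pos)
    · exact fun x _ => Finset.mem_range.2 (Nat.mod_lt _ hp.pos)
    · intro x hx
      rw [Nat.mod_add_mod, show x + m + (p - m) = x + p by omega, Nat.add_mod_right,
        Nat.mod_eq_of_lt (Finset.mem_range.1 hx)]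
    · intro x hx
      rw [Nat.mod_add_mod, show x + (p - m) + m = x + p by omega, Nat.add_mod_right,
        Nat.mod_eq_of_lt (Finset.mem_range.1 hx)]
    · intro x hx
      have hx' : ((x + m) % p + (p - m)) % p = x := by
        rw [Nat.mod_add_mod, show x + m + (p - m) = x + p by omega, Nat.add_mod_right,
          Nat.mod_eq_of_lt (Finset.mem_range.1 hx)]
      simp only [hx']
      rw [mul_comm]
      congr 1
      apply shortResidue_congr
      have h1 : (r * ((x + m) % p) : ℕ) ≡ r * x + 1 [MOD p] :=
        ((Nat.mod_modEq _ _).mul_left r).trans (by rw [mul_add]; exact hrm.add_left _)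
      have h2 : (q : ℤ) * ((r * ((x + m) % p) : ℕ) : ℤ) ≡ q * ((r * x + 1 : ℕ) : ℤ)
          [ZMOD q * p] := (Int.natCast_modEq_iff.2 h1).mul_left'
      have h3 := ((Int.ModEq.refl ((n : ℤ) - r * (p * y))).sub h2).symm
      rw [Nat.cast_mul p q, mul_comm (p : ℤ) q]
      convert h3 using 1
      · push_cast; ring
      · push_cast; ring

theorem eq_of_shortResidue_eq_one {p q r y y' : ℕ} {c : ℤ} (hp : p.Prime) (hq : q.Prime)
    (hr : r.Prime) (hqr : q ≠ r) (hy : y < q) (hy' : y' < q)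
    (h : shortResidue p q (c - r * (p * y)) = 1) (h' : shortResidue p q (c - r * (p * y')) = 1) :
    y = y' := by
  simp only [shortResidue, ite_eq_left_iff, zero_ne_one, imp_false, not_not] at h h'
  set j := (c - r * (p * y)) % (p * q : ℕ) with hj
  set j' := (c - r * (p * y')) % (p * q : ℕ) with hj'
  have hpos : ((p * q : ℕ) : ℤ) ≠ 0 := by exact_mod_cast (Nat.mul_pos hp.pos hq.pos).ne'
  have hj0 : 0 ≤ j := Int.emod_nonneg _ hpos
  have hj0' : 0 ≤ j' := Int.emod_nonneg _ hpos
  have d : ((p * q : ℕ) : ℤ) ∣ c - r * (p * y) - j := Int.dvd_self_sub_emod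
  have d' : ((p * q : ℕ) : ℤ) ∣ c - r * (p * y') - j' := Int.dvd_self_sub_emod
  have d'' := dvd_sub d d'
  have hp0 : (p : ℤ) ≠ 0 := by exact_mod_cast hp.ne_zero
  obtain ⟨k, hk⟩ := d''
  push_cast at hk
  have hjj : j = j' := by
    have h1 : (p : ℤ) ∣ j' - j := ⟨q * k + r * (y - y'), by linear_combination hk⟩
    have := Int.eq_zero_of_abs_lt_dvd h1 (by rw [abs_lt]; constructor <;> linarith)
    linarith
  have h4 : (q : ℤ) ∣ r * ((y' : ℤ) - y) :=
    ⟨k, mul_left_cancel₀ hp0 (by linear_combination hk + hjj)⟩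
  have h6 : (q : ℤ) ∣ (y' : ℤ) - y := by
    refine IsCoprime.dvd_of_dvd_mul_left ?_ h4
    exact Nat.isCoprime_iff_coprime.2 ((Nat.coprime_primes hq hr).2 hqr)
  have := Int.eq_zero_of_abs_lt_dvd h6 (by rw [abs_lt]; constructor <;> omega)
  omega

theorem exists_shortResidue_eq_one {p q r : ℕ} (hp : p.Prime) (hq : q.Prime) (hr : r.Prime)
    (hpq : p ≠ q) (hqr : q ≠ r) (c : ℤ) :
    ∃ y < q, shortResidue p q (c - r * (p * y)) = 1 := by
  have hcop : IsCoprime ((r * p : ℕ) : ℤ) q := Nat.isCoprime_iff_coprime.2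
    (((Nat.coprime_primes hr hq).2 hqr.symm).mul_left ((Nat.coprime_primes hp hq).2 hpq))
  have hcop' : IsCoprime (p : ℤ) q := Nat.isCoprime_iff_coprime.2 ((Nat.coprime_primes hp hq).2 hpq)
  have hp0 : (p : ℤ) ≠ 0 := by exact_mod_cast hp.ne_zero
  have hq0 : (q : ℤ) ≠ 0 := by exact_mod_cast hq.ne_zero
  obtain ⟨a, b, hab⟩ := hcop
  set j := c % p with hj
  have hj0 : 0 ≤ j := Int.emod_nonneg _ hp0
  have hjp : j < p := Int.emod_lt_of_pos _ (by exact_mod_cast hp.pos)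
  set y := (a * (c - j)) % q with hy
  have hy0 : 0 ≤ y := Int.emod_nonneg _ hq0
  have hyq : y < q := Int.emod_lt_of_pos _ (by exact_mod_cast hq.pos)
  refine ⟨y.toNat, by omega, ?_⟩
  rw [Int.toNat_of_nonneg hy0]
  have dp : (p : ℤ) ∣ c - r * (p * y) - j := by
    obtain ⟨k, hk⟩ : (p : ℤ) ∣ c - j := Int.dvd_self_sub_emod
    exact ⟨k - r * y, by linear_combination hk⟩
  have dq : (q : ℤ) ∣ c - r * (p * y) - j := by
    obtain ⟨k, hk⟩ : (q : ℤ) ∣ a * (c - j) - y := Int.dvd_self_sub_emod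
    refine ⟨b * (c - j) + r * p * k, ?_⟩
    push_cast at hab
    linear_combination (r * p : ℤ) * hk - (c - j) * hab
  have d : ((p * q : ℕ) : ℤ) ∣ c - r * (p * y) - j := by
    push_cast
    exact hcop'.mul_dvd dp dq
  rw [shortResidue_congr (w := j) (Int.modEq_iff_dvd.2 ((dvd_sub_comm).1 d)),
    shortResidue_of_nonneg_of_lt hj0 (hjp.trans_le (by
      exact_mod_cast Nat.le_mul_of_pos_right p hq.pos)), if_pos hjp]

/-- For each `x` only one `y` survives in `coeff_cyclotomic_eq_sum_sub`, which leaves a sum of `p`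
differences. -/
theorem coeff_cyclotomic_eq_sum_of_shortResidue_eq_one {p q r l m : ℕ} (hp : p.Prime)
    (hq : q.Prime) (hr : r.Prime) (hpq : p ≠ q) (hpr : p ≠ r) (hqr : q ≠ r) (hl : q + 1 = l * p)
    (hm : m < p) (hrm : r * m ≡ 1 [MOD p]) {n : ℕ} {Y : ℕ → ℕ} (hY : ∀ x < p, Y x < q)
    (hY' : ∀ x < p, shortResidue p q (n - r * (q * x + p * Y x)) = 1) :
    (Polynomial.cyclotomic (p * q * r) ℤ).coeff n = ∑ x ∈ Finset.range p,
      (truncatedCoeff p q l r n x (Y x) - truncatedCoeff p q l r n ((x + (p - m)) % p) (Y x)) := by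
  rw [coeff_cyclotomic_eq_sum_sub hp hq hr hpq hpr hqr hl hm hrm]
  refine Finset.sum_congr rfl fun x hx => ?_
  rw [Finset.mem_range] at hx
  rw [Finset.sum_eq_single_of_mem (Y x) (Finset.mem_range.2 (hY x hx)), hY' x hx, one_mul]
  intro y hy hne
  have h0 : shortResidue p q (n - r * (q * x + p * y)) = 0 := by
    by_contra h
    have h1 : shortResidue p q (n - r * (q * x + p * y)) = 1 := by
      unfold shortResidue at h ⊢
      split_ifs at h ⊢ <;> simp_all
    have h2 := hY' x hx
    rw [mul_add, ← sub_sub] at h1 h2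
    exact hne (eq_of_shortResidue_eq_one hp hq hr hqr (Finset.mem_range.1 hy) (hY x hx) h1 h2)
  rw [h0, zero_mul]

/-! ### The upper bound -/

/-- Whatever the value of `y`, only the `m` indices `x < m` can contribute a positive difference.
For `y < l` the rotation from `x ≥ m` to `x - m` decreases the exponent, hence stays within the
truncation; for `y ≥ l` the only source of a positive difference is `x - m ≡ p - 1`, that is,
`x = m - 1`. -/
theorem truncatedCoeff_sub_le {p q l r n m x : ℕ} (hm : m < p) (hm0 : 0 < m) (hx : x < p) (y : ℕ) :
    truncatedCoeff p q l r n x y - truncatedCoeff p q l r n ((x + (p - m)) % p) y ≤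
      if x < m then 1 else 0 := by
  rw [add_sub_mod_eq hm hx]
  by_cases hxm : x < m
  · simp only [if_pos hxm, truncatedCoeff]
    split_ifs <;> simp_all
  · simp only [if_neg hxm, truncatedCoeff]
    have hmono : r * (q * (x - m) + p * y) ≤ r * (q * x + p * y) := by gcongr; omega
    have h1 : x - m < p - 1 := by omega
    simp only [h1, h1.ne, true_and, false_and, if_false]
    split_ifs <;> omega

theorem sum_range_ite_lt {m p : ℕ} (h : m ≤ p) :
    ∑ x ∈ Finset.range p, (if x < m then (1 : ℤ) else 0) = m := by
  rw [Finset.sum_boole, Finset.range_eq_Ico, Finset.Ico_filter_lt, Nat.card_Ico]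
  simp [h]

theorem coeff_cyclotomic_le {p q r l m : ℕ} (hp : p.Prime)
    (hq : q.Prime) (hr : r.Prime) (hpq : p ≠ q) (hpr : p ≠ r) (hqr : q ≠ r) (hl : q + 1 = l * p)
    (hm : m < p) (hm0 : 0 < m) (hrm : r * m ≡ 1 [MOD p]) (n : ℕ) :
    (Polynomial.cyclotomic (p * q * r) ℤ).coeff n ≤ m := by
  choose Y hY hY' using fun x : ℕ =>
    exists_shortResidue_eq_one hp hq hr hpq hqr ((n : ℤ) - r * (q * x))
  rw [coeff_cyclotomic_eq_sum_of_shortResidue_eq_one hp hq hr hpq hpr hqr hl hm hrm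
    (fun x _ => hY x) (fun x _ => by rw [mul_add, ← sub_sub]; exact hY' x), ← sum_range_ite_lt hm.le]
  exact Finset.sum_le_sum fun x hx =>
    truncatedCoeff_sub_le hm hm0 (Finset.mem_range.1 hx) _

/-! ### A coefficient attaining the bound -/

/-- If `c ≡ r (m - 2) q` modulo `p q`, then `c - r (q x + p y)` has the short residue `i K + e`
whenever `x = e m + m - 2 - i` and `y ≡ i + e d` modulo `q`. -/
theorem shortResidue_eq_one_of_dvd {p q r l m K d : ℕ} (hpq : p.Coprime q) (hl : q + 1 = l * p)
    (hpK : p = m * K + 1) (hd : q + 1 = K * d) (hrp : (p : ℤ) ∣ r + K) (hrq : (q : ℤ) ∣ r * p + K)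
    {c z : ℤ} (hc : ((p * q : ℕ) : ℤ) ∣ c - r * ((m - 2) * q)) {i e x y : ℤ}
    (hx : x = e * m + m - 2 - i)
    (hy : (q : ℤ) ∣ y - (i + e * d)) (hz : z = c - r * (q * x + p * y)) (h0 : 0 ≤ i * K + e)
    (h1 : i * K + e < p) (hq : 0 < q) : shortResidue p q z = 1 := by
  have hlz : (q : ℤ) + 1 = l * p := by exact_mod_cast hl
  have hpKz : (p : ℤ) = m * K + 1 := by exact_mod_cast hpK
  have hdz : (q : ℤ) + 1 = K * d := by exact_mod_cast hd
  obtain ⟨a, ha⟩ := hrp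
  obtain ⟨b, hb⟩ := hrq
  obtain ⟨s, hs⟩ := hc
  obtain ⟨u, hu⟩ := hy
  push_cast at hs
  have dp : (p : ℤ) ∣ z - (i * K + e) := by
    refine ⟨q * s - r * y + (i - e * m) * (r * l - a) - e, ?_⟩
    subst hx hz
    linear_combination hs + r * (i - e * m) * hlz - (i - e * m) * ha + e * hpKz
  have dq : (q : ℤ) ∣ z - (i * K + e) := by
    refine ⟨p * s + r * (m - 2 - x) - y * b + e + K * u, ?_⟩
    subst hz
    linear_combination hs - y * hb + K * hu - e * hdz
  have d : ((p * q : ℕ) : ℤ) ∣ z - (i * K + e) := by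
    push_cast
    exact (Nat.isCoprime_iff_coprime.2 hpq).mul_dvd dp dq
  rw [shortResidue_congr (Int.modEq_iff_dvd.2 (dvd_sub_comm.1 d)),
    shortResidue_of_nonneg_of_lt h0 (h1.trans_le (by
      exact_mod_cast Nat.le_mul_of_pos_right p hq)), if_pos h1]

/-- If `t` is the integer part of `n / r`, the truncation in `truncatedCoeff` is by `t`. -/
theorem truncatedCoeff_eq {p q l r n t : ℕ} (h1 : r * t ≤ n) (h2 : n < r * (t + 1)) (x y : ℕ) :
    truncatedCoeff p q l r n x y =
      if y < l then if x < p - 1 ∧ q * x + p * y ≤ t then 1 else 0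
      else if x = p - 1 ∧ p * y ≤ t + q then -1 else 0 := by
  have e1 : ∀ i, r * i ≤ n ↔ i ≤ t := fun i =>
    ⟨fun h => by
      by_contra! hi
      exact absurd (h2.trans_le (Nat.mul_le_mul_left r hi)) (by omega),
    fun h => (Nat.mul_le_mul_left r h).trans h1⟩
  have e2 : ∀ i, r * i ≤ n + r * q ↔ i ≤ t + q := fun i =>
    ⟨fun h => by
      by_contra! hi
      have := Nat.mul_le_mul_left r (show t + 1 + q ≤ i by omega)
      rw [mul_add] at this
      omega,
    fun h => (Nat.mul_le_mul_left r h).trans (by rw [mul_add]; omega)⟩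
  simp only [truncatedCoeff, e1, e2]

/-- For `n` with `n / r` of integer part `m q` and the value of `y` belonging to
`x + 1 = m e + ρ`, the bound of `truncatedCoeff_sub_le` is attained at every `x`. -/
theorem truncatedCoeff_sub_eq {p q l r n m K d x e ρ : ℕ} (hq : 0 < q) (hl : l * p = q + 1)
    (hpq : p ≤ q) (hm : 2 ≤ m) (hK : 3 ≤ K) (hpK : p = m * K + 1) (hd : K * d = q + 1)
    (hqm : 3 * (p * m) < q) (hn1 : r * (m * q) ≤ n) (hn2 : n < r * (m * q + 1)) (hx : x < p)
    (hx1 : m * e + ρ = x + 1) (hρ : ρ < m) (he : e ≤ K) {y : ℕ}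
    (hy : y = if e = K then m - ρ else m - 1 - ρ + e * d) :
    truncatedCoeff p q l r n x y - truncatedCoeff p q l r n ((x + (p - m)) % p) y =
      if x < m then 1 else 0 := by
  have hmp : 2 * m + 2 < p := by nlinarith
  have hml : m < l := by
    by_contra! h
    nlinarith [Nat.mul_le_mul_right p h]
  have hld : l ≤ d := by
    by_contra! h
    have : K * d ≤ p * d := by gcongr; nlinarith
    nlinarith
  have hd3 : 3 * d ≤ q + 1 := by rw [← hd]; gcongr
  have hpp : p - 1 = m * K := by omega
  rw [add_sub_mod_eq (by omega) hx, truncatedCoeff_eq hn1 hn2, truncatedCoeff_eq hn1 hn2, hy]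
  rcases Nat.eq_zero_or_pos e with rfl | he0
  -- Here `y = m - 1 - ρ < l`: the exponent of `x` is within the truncation, and that of the
  -- rotated index `x + (p - m)` exceeds it.
  · have hxm : x < m := by omega
    have h1 : q * x + p * (m - 1 - ρ) ≤ m * q := by
      have h2 : p * (m - 1 - ρ) ≤ q * (m - 1 - ρ) := by gcongr
      have h3 : q * (x + (m - 1 - ρ)) ≤ q * m := by gcongr; omega
      rw [mul_add] at h3
      linarith
    have h4 : m * q < q * (x + (p - m)) := by
      rw [mul_comm]
      exact Nat.mul_lt_mul_of_pos_left (by omega) hq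
    rw [if_neg (c := 0 = K) (by omega), zero_mul, add_zero, if_pos (by omega), if_pos ⟨by omega, h1⟩,
      if_pos (by omega), if_pos hxm, if_neg (by omega), if_pos hxm, sub_zero]
  · rcases he.lt_or_eq with he | rfl
    -- Here `y ≥ l`, and both coefficients vanish unless the rotated index is `p - 1`, that is,
    -- `x = m - 1`; the exponent `p y - q` is then still within the truncation.
    · have hY : l ≤ m - 1 - ρ + e * d := by
        have := Nat.le_mul_of_pos_left d he0
        omega
      have hxp : x ≠ p - 1 := by
        have := Nat.mul_le_mul_left m (show e + 1 ≤ K from he)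
        rw [mul_add] at this
        omega
      have hme : m ≤ m * e := Nat.le_mul_of_pos_right m he0
      rw [if_neg he.ne, if_neg (by omega), if_neg (by omega), if_neg (by omega)]
      by_cases hxm : x < m
      · have hρ0 : ρ = 0 := by omega
        have he1 : e = 1 := by
          have : m * e = m * 1 := by omega
          exact Nat.eq_of_mul_eq_mul_left (by omega) this
        have hpd : p * d = m * q + m + d := by
          rw [hpK, add_mul, mul_assoc, hd]; ring
        have h1 : p * (m - 1 - ρ + e * d) ≤ m * q + q := by
          have h2 : p * (m - 1 - ρ) ≤ p * m := by gcongr; omega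
          have h3 : p * 2 ≤ p * m := by gcongr
          rw [he1, one_mul, mul_add]
          omega
        rw [if_pos hxm, if_pos hxm, if_pos ⟨by omega, h1⟩]
        rfl
      · rw [if_neg hxm, if_neg hxm, if_neg (by omega)]
        rfl
    -- Here `x` is `p - 2` or `p - 1` and `y ≤ m < l`: both exponents exceed the truncation.
    · have hme : m * 3 ≤ m * e := by gcongr
      have h1 : m * q < q * x := by
        rw [mul_comm]
        exact Nat.mul_lt_mul_of_pos_left (by omega) hq
      have h2 : m * q < q * (x - m) := by
        rw [mul_comm]
        exact Nat.mul_lt_mul_of_pos_left (by omega) hq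
      rw [if_pos rfl, if_pos (by omega), if_neg (by omega), if_pos (by omega),
        if_neg (c := x < m) (by omega), if_neg (by omega), if_neg (by omega)]
      rfl

theorem exists_coeff_cyclotomic_eq {p q r l m K d : ℕ} (hp : p.Prime) (hq : q.Prime)
    (hr : r.Prime) (hpq : p ≠ q) (hpr : p ≠ r) (hqr : q ≠ r) (hl : q + 1 = l * p)
    (hrm : r * m ≡ 1 [MOD p]) (hm : 2 ≤ m) (hK : 3 ≤ K) (hpK : p = m * K + 1)
    (hd : q + 1 = K * d) (hrp : (p : ℤ) ∣ r + K) (hrq : (q : ℤ) ∣ r * p + K)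
    (hqm : 3 * (p * m) < q) (hr_gt : p * q < r) :
    ∃ n, (Polynomial.cyclotomic (p * q * r) ℤ).coeff n = m := by
  have hmp : 2 * m + 2 < p := by nlinarith
  have hpq' : p < q := by nlinarith
  have hml : m < l := by
    by_contra! h
    nlinarith [Nat.mul_le_mul_right p h]
  have hld : l ≤ d := by
    by_contra! h
    have : K * d ≤ p * d := by gcongr; nlinarith
    nlinarith
  -- `n ≡ r (m - 2) q` modulo `p q`, so that `x = m - 2`, `y = 0` belongs to the residue `j = 0`; the
  -- multiple of `p q` makes `m q` the integer part of `n / r`, which is possible as `p q < r`.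
  set n := r * ((m - 2) * q) + p * q * (2 * r / p + 1) with hn
  have hdiv : 2 * r < p * (2 * r / p + 1) := Nat.lt_mul_div_succ _ hp.pos
  have hdiv' : p * (2 * r / p + 1) ≤ 2 * r + p := by
    have := Nat.mul_div_le (2 * r) p
    rw [mul_add, mul_one]; omega
  have hm2 : (m - 2) * q + 2 * q = m * q := by rw [← add_mul, Nat.sub_add_cancel hm]
  have hn1 : r * (m * q) ≤ n := by
    have := Nat.mul_le_mul_left q hdiv.le
    rw [← hm2]; nlinarith
  have hn2 : n < r * (m * q + 1) := by
    have := Nat.mul_le_mul_left q hdiv'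
    rw [← hm2]; nlinarith
  have hc : ((p * q : ℕ) : ℤ) ∣ (n : ℤ) - r * (((m : ℤ) - 2) * q) := by
    refine ⟨(2 * r / p + 1 : ℕ), ?_⟩
    rw [hn]
    push_cast [Nat.cast_sub hm]
    ring
  refine ⟨n, ?_⟩
  -- With `e = (x + 1) / m` and `i = m - 1 - (x + 1) % m`, the index `x` belongs to the residue
  -- `j = i K + e`, and `y ≡ i + e d` modulo `q`. As `K d = q + 1`, this is reduced to `i + 1` if
  -- `e = K`.
  let Y : ℕ → ℕ := fun x => if (x + 1) / m = K then m - (x + 1) % m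
    else m - 1 - (x + 1) % m + (x + 1) / m * d
  have hmod : ∀ x, (x + 1) % m < m := fun x => Nat.mod_lt _ (by omega)
  have hdm : ∀ x, m * ((x + 1) / m) + (x + 1) % m = x + 1 := fun x => Nat.div_add_mod _ _
  have heK : ∀ x < p, (x + 1) / m ≤ K := fun x hx => by
    by_contra! h
    have := Nat.mul_le_mul_left m h
    have := hdm x
    rw [Nat.mul_succ] at *
    omega
  rw [coeff_cyclotomic_eq_sum_of_shortResidue_eq_one (Y := Y) hp hq hr hpq hpr hqr hl (by omega) hrm,
    ← sum_range_ite_lt (show m ≤ p by omega)]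
  · refine Finset.sum_congr rfl fun x hx => ?_
    rw [Finset.mem_range] at hx
    exact truncatedCoeff_sub_eq hq.pos hl.symm hpq'.le hm hK hpK hd.symm hqm hn1 hn2 hx (hdm x)
      (hmod x) (heK x hx) rfl
  · intro x hx
    have hρ := hmod x
    have he := heK x hx
    simp only [Y]
    split_ifs with h
    · omega
    · have h1 : ((x + 1) / m + 1) * d ≤ K * d := by gcongr; omega
      rw [add_mul, one_mul, ← hd] at h1
      omega
  · intro x hx
    have hρ := hmod x
    have he := heK x hx
    have hx1 : (m : ℤ) * ((x + 1) / m : ℕ) + ((x + 1) % m : ℕ) = x + 1 := by exact_mod_cast hdm x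
    have hd' : (q : ℤ) + 1 = K * d := by exact_mod_cast hd
    refine shortResidue_eq_one_of_dvd ((Nat.coprime_primes hp hq).2 hpq) hl hpK hd hrp hrq hc
      (i := (m - 1 - (x + 1) % m : ℕ)) (e := ((x + 1) / m : ℕ)) (x := x) (y := Y x) ?_ ?_ rfl
      (by positivity) ?_ hq.pos
    · push_cast [Nat.cast_sub (show (x + 1) % m ≤ m - 1 by omega),
        Nat.cast_sub (show 1 ≤ m by omega)] at hx1 ⊢
      linear_combination -hx1
    · simp only [Y]
      split_ifs with h
      · refine ⟨-1, ?_⟩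
        rw [h, show m - (x + 1) % m = m - 1 - (x + 1) % m + 1 by omega]
        push_cast
        linear_combination hd'
      · push_cast
        simp
    · have h1 : (m - 1 - (x + 1) % m) * K ≤ (m - 1) * K :=
        Nat.mul_le_mul_right K (Nat.sub_le _ _)
      have h2 : (m - 1) * K + K = m * K := by
        rw [← Nat.succ_mul, Nat.succ_eq_add_one, Nat.sub_add_cancel (by omega)]
      exact_mod_cast (by omega : (m - 1 - (x + 1) % m) * K + (x + 1) / m < p)

theorem isGreatest_range_coeff_cyclotomic {p q r l m K d : ℕ} (hp : p.Prime) (hq : q.Prime)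
    (hr : r.Prime) (hpq : p ≠ q) (hpr : p ≠ r) (hqr : q ≠ r) (hl : q + 1 = l * p)
    (hrm : r * m ≡ 1 [MOD p]) (hm : 2 ≤ m) (hK : 3 ≤ K) (hpK : p = m * K + 1)
    (hd : q + 1 = K * d) (hrp : (p : ℤ) ∣ r + K) (hrq : (q : ℤ) ∣ r * p + K)
    (hqm : 3 * (p * m) < q) (hr_gt : p * q < r) :
    IsGreatest (Set.range fun j : ℕ => (Polynomial.cyclotomic (p * q * r) ℤ).coeff j) (m : ℤ) := by
  refine ⟨exists_coeff_cyclotomic_eq hp hq hr hpq hpr hqr hl hrm hm hK hpK hd hrp hrq hqm hr_gt, ?_⟩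
  rintro _ ⟨n, rfl⟩
  exact coeff_cyclotomic_le hp hq hr hpq hpr hqr hl (by nlinarith) (by omega) hrm n

/-! ### Choice of the primes -/

/-- The primes come from Dirichlet's theorem: `p ≡ 1` modulo `m`, then `q ≡ -1` modulo `p K`, then
`r` in the class `-K (1 + p l (l - 1))` modulo `p q`, which is `-K` modulo `p` and, as `p l ≡ 1`,
is `-K l` modulo `q`. -/
theorem exists_primes_with_residues {m : ℕ} (hm : 2 ≤ m) : ∃ p q r l K d : ℕ,
    p.Prime ∧ q.Prime ∧ r.Prime ∧ q + 1 = l * p ∧ r * m ≡ 1 [MOD p] ∧ 3 ≤ K ∧ p = m * K + 1 ∧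
    q + 1 = K * d ∧ (p : ℤ) ∣ r + K ∧ (q : ℤ) ∣ r * p + K ∧ 3 * (p * m) < q ∧ p * q < r := by
  obtain ⟨p, hp_gt, hp, hpm⟩ := Nat.forall_exists_prime_gt_and_zmodEq (3 * m) (q := m) (a := 1)
    (by omega) isCoprime_one_left
  obtain ⟨K, hK⟩ : m ∣ p - 1 := by
    have := (Int.natCast_modEq_iff (a := p) (b := 1) (n := m)).1 (by exact_mod_cast hpm)
    exact (Nat.modEq_iff_dvd' hp.one_le).1 this.symm
  have hpK : p = m * K + 1 := by have := hp.one_le; omega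
  have hK3 : 3 ≤ K := by by_contra! h; nlinarith
  obtain ⟨q, hq_gt, hq, hqm⟩ := Nat.forall_exists_prime_gt_and_zmodEq (3 * (p * m)) (q := p * K)
    (a := -1) (by have := hp.pos; positivity) isCoprime_one_left.neg_left
  obtain ⟨s, hs⟩ : p * K ∣ q + 1 := by
    have := (Int.modEq_iff_dvd.1 hqm.symm)
    rw [sub_neg_eq_add] at this
    exact_mod_cast this
  have hl : q + 1 = K * s * p := by rw [hs]; ring
  set l := K * s with hl_def
  have hKs : (l : ℤ) = K * s := by exact_mod_cast hl_def
  have hlz : (q : ℤ) + 1 = l * p := by exact_mod_cast hl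
  have hpKz : (p : ℤ) = m * K + 1 := by exact_mod_cast hpK
  set c : ℤ := 1 + p * l * (l - 1) with hc
  have hcp : IsCoprime (-K * c) (p : ℤ) :=
    IsCoprime.mul_left ⟨m, 1, by linear_combination hpKz⟩ ⟨1, -l * (l - 1), by rw [hc]; ring⟩
  have hcq : IsCoprime (-K * c) (q : ℤ) :=
    IsCoprime.mul_left ⟨-(p * s), -1, by linear_combination -hlz - p * hKs⟩
      ⟨p, -(1 + p * (l - 1)), by rw [hc]; linear_combination (-p * (l - 1) - 1) * hlz⟩
  obtain ⟨r, hr_gt, hr, hrc⟩ := Nat.forall_exists_prime_gt_and_zmodEq (p * q) (q := p * q)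
    (a := -K * c) (Nat.mul_pos hp.pos hq.pos).ne' (by push_cast; exact hcp.mul_right hcq)
  obtain ⟨k, hk⟩ := Int.modEq_iff_dvd.1 hrc.symm
  push_cast at hk
  refine ⟨p, q, r, l, K, p * s, hp, hq, hr, hl, ?_, hK3, hpK, by rw [hs]; ring, ?_, ?_, hq_gt,
    hr_gt⟩
  · refine Nat.ModEq.symm (Int.natCast_modEq_iff.1 (Int.modEq_iff_dvd.2
      ⟨q * k * m - K * m * l * (l - 1) - 1, ?_⟩))
    push_cast
    rw [hc] at hk
    linear_combination m * hk + hpKz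
  · refine ⟨q * k - K * l * (l - 1), ?_⟩
    rw [hc] at hk
    linear_combination hk
  · refine ⟨p ^ 2 * k - K * (1 + p * (l - 1)), ?_⟩
    rw [hc] at hk
    linear_combination p * hk + (K * p * (l - 1) + K) * hlz

theorem theorem4 (hAndrica : AndricaConjecture) (m : ℕ) (hm : 1 ≤ m) :
    ∃ n : ℕ, 1 ≤ n ∧
      IsGreatest (Set.range fun j : ℕ => (Polynomial.cyclotomic n ℤ).coeff j) (m : ℤ) := by
  obtain rfl | hm := hm.eq_or_lt
  · refine ⟨1, le_rfl, ⟨1, ?_⟩, ?_⟩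
    · simp [Polynomial.coeff_one]
    · rintro _ ⟨j, rfl⟩
      simp only [Polynomial.cyclotomic_one, Polynomial.coeff_sub, Polynomial.coeff_X,
        Polynomial.coeff_one]
      split_ifs <;> simp
  · obtain ⟨p, q, r, l, K, d, hp, hq, hr, hl, hrm, hK, hpK, hd, hrp, hrq, hqm, hr_gt⟩ :=
      exists_primes_with_residues hm
    have hpq : p < q := by nlinarith
    have hqr : q < r := by nlinarith [hp.two_le]
    exact ⟨p * q * r, Nat.mul_pos (Nat.mul_pos hp.pos hq.pos) hr.pos,
      isGreatest_range_coeff_cyclotomic hp hq hr hpq.ne (hpq.trans hqr).ne hqr.ne hl hrm hm hK hpK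
        hd hrp hrq hqm hr_gt⟩
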